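/- Setting. The framework is fine-grained concurrent separation logic with subjective states. A PCM is a partial commutative monoid $(U,\bullet,1)$. A state of type $(U,T)$ is a triple $s=(a_s,a_j,a_o)\in U\times T\times U$ (self, joint, other), with transpose $s^\top=(a_o,a_j,a_s)$ and framings $s\lhd p=(a_s\bullet p,a_j,a_o)$ and $s\rhd p=(a_s,a_j,p\bullet a_o)$. A state space $S$ is a predicate on states with $S(s\lhd p)\Leftrightarrow S(s\rhd p)$ and $S(s)\Rightarrow a_s\bullet a_o$ defined; it comes with a flattening $\lfloor\cdot\rfloor$ of states into heaps that is defined on $S$ and satisfies $\lfloor s\lhd p\rfloor=\lfloor s\rhd p\rfloor$. A transition is a relation $t$ on states that is functional, fixes $a_o$, preserves $S$, and is local: if $t\,(s\rhd p)\,s'$ then $s'=s''\rhd p$ and $t\,(s\lhd p)\,(s''\lhd p)$ for some $s''$. It is internal if $\lfloor s\rfloor,\lfloor s'\rfloor$ have the same domain whenever $t\,s\,s'$. A resource $V$ consists of a state space with flattening, a set $V_{\mathrm{int}}$ of internal transitions and a set $V_{\mathrm{ext}}$ of (external) transitions. Write $s\to_V^* s'$ for the reflexive-transitive closure of: $t\,s^\top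 s'^\top$ for some $t\in V_{\mathrm{int}}\cup V_{\mathrm{ext}}$. Indexed families. An indexed morphism family $f:V\to^X W$ consists, for each $x\in X$, of a relation $f\,x$ between states in $S_V$ and states in $S_W$ and a map $f\,x:V_{\mathrm{int}}\to W_{\mathrm{int}}$, such that (1) if $t\in V_{\mathrm{int}}$, $t\,s_v\,s_v'$ and $(s_v,s_w)\in f\,x$, then $(f\,x\,t)\,s_w\,s_w'$ and $(s_v',s_w')\in f\,x'$ for some $x',s_w'$; (2) if $s_w\to_W^* s_w'$ and $(s_v,s_w)\in f\,x$, then $s_v\to_V^* s_v'$ and $(s_v',s_w')\in f\,x$ for some $s_v'$; (3) if $(s_{v1},s_w),(s_{v2},s_w)\in f\,x$ then $s_{v1}=s_{v2}$; (4) there is $\phi:U_W\to U_V$ such that $(s_v,s_w\rhd p)\in f\,x$ implies $s_v=s_v'\rhd\phi(p)$ and $(s_v'\lhd\phi(p),s_w\lhd p)\in f\,x$ for some $s_v'$; (5) if $(s_v,s_w)\in f\,x$, $(s_v',s_w')\in f\,x'$ and $a_o(s_w)=a_o(s_w')$, then $a_o(s_v)=a_o(s_v')$; (6) if $(s_v,s_{w1})\in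 f\,x_1$ and $(s_v,s_{w2})\in f\,x_2$ then $x_1=x_2$. Programs over $V$ are sets of action trees (built from unfinished, return, atomic actions, sequential and parallel composition, and morphing by a family), containing the unfinished tree, with the small-step semantics in which an action under a context of families takes the image of its transition. The triple $e:\{P\}\,A\,\{Q\}@V$ says: started in any $s\in S_V$ satisfying $P$, and under arbitrary interference $\to_V^*$ before, between and after the steps, every tree of $e$ stays safe (each well-formed reduction is enabled), and $Q$ holds whenever it has been reduced to a returned value. $\mathsf{morph}\,f\,x\,e$ lifts a program from $V$ to $W$, starting at index $x$. The two resources. Heaps are finite maps from non-null pointers to values; histories are finite maps from time-stamps to pairs of lists (abstract contents before and after an operation); both are PCMs under disjoint union. Let $\mathsf{layout}\,\alpha$ be, for each list $\alpha$, a precise predicate on heaps (a defined heap has at most one subheap satisfying it). $\mathsf{Priv}$ has states $(\sigma_s,(),\sigma_o)$ with $\sigma_s\bullet\sigma_o$ defined; its internal transitions are all internal transitions over this space (idling and domain-preserving updates of $\sigma_s$), its external ones receive a heap into, or give a heap away from, $\sigma_s$. $\mathsf{Stack}$ has states $((\sigma_s,\tau_s),(\sigma_j,\alpha),(\sigma_o,\tau_o))$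 such that $\sigma_s\bullet\sigma_j\bullet\sigma_o$ is defined, $\mathsf{layout}\,\alpha\,\sigma_j$ holds, and $\tau_s\bullet\tau_o$ records, at time-stamps $1,\dots,n$ without gaps, consecutive pushes and pops leading from $\mathsf{nil}$ to $\alpha$. Its internal transitions are all those internal transitions over this space which change only $\sigma_s$ (idling included), and those from an arbitrary given set of operations that either keep $\alpha$ and $\tau_s$, or push or pop one element of $\alpha$ and add the corresponding entry to $\tau_s$. Its external transitions receive and give away private heaps. Statement. For $\tau\in\mathsf{hist}$, let $(s_v,s_w)\in f\,\tau$ hold, for a $\mathsf{Stack}$-state $s_v$ and a $\mathsf{Priv}$-state $s_w$ in the respective state spaces, iff $$\sigma_s(s_w)=\sigma_s(s_v)\bullet\sigma_j(s_v),\quad \sigma_o(s_w)=\sigma_o(s_v),\quad \tau_s(s_v)=\tau,\quad \tau_o(s_v)=\mathsf{empty}.$$ (i) Together with some transition component, $f$ is an indexed morphism family $\mathsf{Stack}\to^{\mathsf{hist}}\mathsf{Priv}$. (ii) Let $f$ be any such family, and let $e$ be any program over $\mathsf{Stack}$ (of any return type) that satisfies the history specification of $\mathsf{push}(1)\parallel\mathsf{push}(2)$: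 $$e:\{\sigma_s=\mathsf{empty}\wedge\tau_s=\mathsf{empty}\}\ \{\sigma_s=\mathsf{empty}\wedge\exists t_1\,vs_1\,t_2\,vs_2.\ \tau_s=t_1\mapsto(vs_1,1{::}vs_1)\bullet t_2\mapsto(vs_2,2{::}vs_2)\}@\mathsf{Stack}.$$ Write $P$ and $Q$ for this precondition and postcondition. Then the lifted program satisfies the conclusion of the lifting rule for families (with the trivial invariant), and the history-free specification: $$\mathsf{morph}\,f\,\mathsf{empty}\,e:\{\exists s_v.\,(s_v,s)\in f\,\mathsf{empty}\wedge P\,s_v\}\ \{\exists\tau\,s_v.\,(s_v,s)\in f\,\tau\wedge Q\,s_v\}@\mathsf{Priv},$$ $$\mathsf{morph}\,f\,\mathsf{empty}\,e:\{\mathsf{layout}\,\mathsf{nil}\,\sigma_s\}\ \{\mathsf{layout}\,[1,2]\,\sigma_s\vee\mathsf{layout}\,[2,1]\,\sigma_s\}@\mathsf{Priv}.$$ -/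

import Mathlib

namespace FCSL

/-! ## Partial commutative monoids, heaps and histories -/

/-- A partial commutative monoid, presented by a total join together with a predicate that says
which elements are defined; an undefined join is represented by an element that is not
`defined`. The join is written `+` and the unit `0`. -/
class PCM (U : Type) extends AddCommMonoid U where
  defined : U → Prop
  defined_zero : defined 0
  defined_of_add : ∀ {x y : U}, defined (x + y) → defined x

instance {U₁ U₂ : Type} [PCM U₁] [PCM U₂] : PCM (U₁ × U₂) where
  defined x := PCM.defined x.1 ∧ PCM.defined x.2
  defined_zero := ⟨PCM.defined_zero, PCM.defined_zero⟩
  defined_of_add h := ⟨PCM.defined_of_add h.1, PCM.defined_of_add h.2⟩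

/-- Finite maps from `K` to `V`, extended by one undefined element. -/
inductive PMap (K V : Type) : Type
  | undef : PMap K V
  | map (m : Finmap fun _ : K => V) : PMap K V

namespace PMap

variable {K V : Type}

/-- The domain of a finite map. -/
def dom : PMap K V → Set K
  | map m => {k | k ∈ m}
  | undef => ∅

/-- The singleton map `k ↦ v`. -/
def single (k : K) (v : V) : PMap K V := map (Finmap.singleton k v)

variable [DecidableEq K]

open Classical in
/-- Disjoint union, undefined if the operands share a key. -/
noncomputable def join : PMap K V → PMap K V → PMap K V
  | map a, map b => if a.Disjoint b then map (a ∪ b) else undef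
  | _, _ => undef

theorem join_undef (x : PMap K V) : join x undef = undef := by
  cases x <;> rfl

theorem undef_join (x : PMap K V) : join undef x = undef := by
  cases x <;> rfl

theorem join_map {a b : Finmap fun _ : K => V} (h : a.Disjoint b) :
    join (map a) (map b) = map (a ∪ b) := if_pos h

theorem join_map_of_not {a b : Finmap fun _ : K => V} (h : ¬ a.Disjoint b) :
    join (map a) (map b) = undef := if_neg h

theorem join_comm (x y : PMap K V) : join x y = join y x := by
  rcases x with _ | a
  · rw [join_undef, undef_join]
  rcases y with _ | b
  · rw [join_undef, undef_join]
  by_cases h : a.Disjoint b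
  · rw [join_map h, join_map (Finmap.Disjoint.symm _ _ h), Finmap.union_comm_of_disjoint h]
  · rw [join_map_of_not h, join_map_of_not (fun k => h (Finmap.Disjoint.symm _ _ k))]

theorem join_assoc (x y z : PMap K V) : join (join x y) z = join x (join y z) := by
  rcases x with _ | a
  · simp only [undef_join]
  rcases y with _ | b
  · simp only [undef_join, join_undef]
  rcases z with _ | c
  · simp only [join_undef]
  by_cases hab : a.Disjoint b
  · by_cases hbc : b.Disjoint c
    · rw [join_map hab, join_map hbc]
      by_cases hac : a.Disjoint c
      · rw [join_map ((Finmap.disjoint_union_left _ _ _).2 ⟨hac, hbc⟩),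
          join_map ((Finmap.disjoint_union_right _ _ _).2 ⟨hab, hac⟩), Finmap.union_assoc]
      · rw [join_map_of_not (fun h => hac ((Finmap.disjoint_union_left _ _ _).1 h).1),
          join_map_of_not (fun h => hac ((Finmap.disjoint_union_right _ _ _).1 h).2)]
    · rw [join_map hab, join_map_of_not hbc, join_undef,
        join_map_of_not (fun h => hbc ((Finmap.disjoint_union_left _ _ _).1 h).2)]
  · rw [join_map_of_not hab, undef_join]
    by_cases hbc : b.Disjoint c
    · rw [join_map hbc,
        join_map_of_not (fun h => hab ((Finmap.disjoint_union_right _ _ _).1 h).1)]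
    · rw [join_map_of_not hbc, join_undef]

theorem empty_join (x : PMap K V) : join (map ∅) x = x := by
  rcases x with _ | a
  · exact join_undef _
  · rw [join_map (Finmap.disjoint_empty a), Finmap.empty_union]

noncomputable instance : PCM (PMap K V) where
  add := join
  zero := map ∅
  add_assoc := join_assoc
  add_comm := join_comm
  zero_add := empty_join
  add_zero x := (join_comm x (map ∅)).trans (empty_join x)
  nsmul := @nsmulRec _ ⟨map ∅⟩ ⟨join⟩
  defined x := x ≠ undef
  defined_zero := by
    intro h
    cases h
  defined_of_add := by
    intro x y h hx
    subst hx
    exact h (undef_join y)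

theorem add_left_cancel {x y z : PMap K V} (h : PCM.defined (x + y)) (e : x + y = x + z) :
    y = z := by
  change join x y ≠ undef at h
  change join x y = join x z at e
  rcases x with _ | a
  · exact absurd (undef_join y) h
  rcases y with _ | b
  · exact absurd (join_undef _) h
  rcases z with _ | c
  · exact absurd (e.trans (join_undef _)) h
  by_cases hab : a.Disjoint b
  · by_cases hac : a.Disjoint c
    · rw [join_map hab, join_map hac] at e
      have e' : a ∪ b = a ∪ c := PMap.map.inj e
      rw [Finmap.union_comm_of_disjoint hab, Finmap.union_comm_of_disjoint hac] at e'
      exact congrArg map ((Finmap.union_cancel (Finmap.Disjoint.symm _ _ hab)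
        (Finmap.Disjoint.symm _ _ hac)).1 e')
    · exact absurd (e.trans (join_map_of_not hac)) h
  · exact absurd (join_map_of_not hab) h

end PMap

/-- Heaps map finitely many non-null pointers to values. -/
abbrev Heap (Val : Type) : Type := PMap ℕ+ Val

/-- Histories map finitely many time-stamps to the abstract change of the stack contents made by
the operation at that time. -/
abbrev Hist : Type := PMap ℕ (List ℕ × List ℕ)

/-- A heap predicate is precise if a defined heap has at most one subheap that satisfies it. -/
def Precise {Val : Type} (P : Heap Val → Prop) : Prop :=
  ∀ h₁ h₂ r₁ r₂ : Heap Val, PCM.defined (h₁ + r₁) → h₁ + r₁ = h₂ + r₂ → P h₁ → P h₂ → h₁ = h₂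

/-! ## States, transitions and resources -/

/-- Subjective states of state-type `(U, T)`. -/
@[ext]
structure State (U T : Type) where
  self : U
  joint : T
  other : U

namespace State

variable {U T : Type} [PCM U]

/-- State transposition. -/
def transpose (s : State U T) : State U T := ⟨s.other, s.joint, s.self⟩

/-- Self-framing. -/
def selfFrame (s : State U T) (p : U) : State U T := ⟨s.self + p, s.joint, s.other⟩

/-- Other-framing. -/
def otherFrame (s : State U T) (p : U) : State U T := ⟨s.self, s.joint, p + s.other⟩

end State

/-- Binary relations between a pre-state and a post-state. -/
abbrev StateRel (U T : Type) : Type := State U T → State U T → Prop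

/-- Transitions over the state space `S`. -/
structure IsTransition {U T : Type} [PCM U] (S : State U T → Prop) (t : StateRel U T) :
    Prop where
  functional : ∀ {s s₁ s₂}, t s s₁ → t s s₂ → s₁ = s₂
  other_fixed : ∀ {s s'}, t s s' → s.other = s'.other
  locality : ∀ {s : State U T} {p : U} {s' : State U T}, t (s.otherFrame p) s' →
    ∃ s'' : State U T, s' = s''.otherFrame p ∧ t (s.selfFrame p) (s''.selfFrame p)
  preserves : ∀ {s s'}, t s s' → S s → S s'

/-- Internal transitions preserve the domain of the flattened heap. -/
structure IsInternal {Val U T : Type} [PCM U] (S : State U T → Prop)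
    (flat : State U T → Heap Val) (t : StateRel U T) : Prop extends IsTransition S t where
  dom_eq : ∀ {s s'}, t s s' → (flat s).dom = (flat s').dom

/-- Resources: a state-type, a state space, a flattening into heaps, and sets of internal and of
external transitions. -/
structure Resource (Val : Type) where
  U : Type
  [pcm : PCM U]
  T : Type
  S : State U T → Prop
  valid : ∀ {s}, S s → PCM.defined (s.self + s.other)
  global : ∀ (s : State U T) (p : U), S (s.selfFrame p) ↔ S (s.otherFrame p)
  flat : State U T → Heap Val
  flat_defined : ∀ {s}, S s → PCM.defined (flat s)
  flat_frame : ∀ (s : State U T) (p : U), flat (s.selfFrame p) = flat (s.otherFrame p)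
  int : Set (StateRel U T)
  int_internal : ∀ t ∈ int, IsInternal S flat t
  ext : Set (StateRel U T)
  ext_transition : ∀ t ∈ ext, IsTransition S t

attribute [instance] Resource.pcm

section Semantics

variable {Val : Type}

/-- States of a resource. -/
abbrev Resource.St (V : Resource Val) : Type := State V.U V.T

/-- One step of interference: a transition of the resource on transposed states. -/
def OtherStep (V : Resource Val) (s s' : V.St) : Prop :=
  ∃ t ∈ V.int ∪ V.ext, t s.transpose s'.transpose

/-- Any finite number of steps of interference. -/
def OtherSteps (V : Resource Val) : V.St → V.St → Prop := Relation.ReflTransGen (OtherStep V)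

/-- Atomic actions of type `A` over a resource. -/
structure Action (V : Resource Val) (A : Type) where
  rel : A → V.int
  functional : ∀ {v₁ v₂ s s₁ s₂}, (rel v₁).1 s s₁ → (rel v₂).1 s s₂ → v₁ = v₂

/-- Indexed morphism families from `V` to `W` over the type `X` of indices. `rel x sv sw` is the
relation `(sv, sw) ∈ f x` on states, and `trans x` the function on internal transitions. -/
structure Family (V W : Resource Val) (X : Type) where
  rel : X → V.St → W.St → Prop
  trans : X → V.int → W.int
  rel_space : ∀ {x sv sw}, rel x sv sw → V.S sv ∧ W.S sw
  sim_int : ∀ {x} {t : V.int} {sv sv' sw}, t.1 sv sv' → rel x sv sw →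
    ∃ x' sw', (trans x t).1 sw sw' ∧ rel x' sv' sw'
  sim_other : ∀ {x sv sw sw'}, OtherSteps W sw sw' → rel x sv sw →
    ∃ sv', OtherSteps V sv sv' ∧ rel x sv' sw'
  functional : ∀ {x sv₁ sv₂ sw}, rel x sv₁ sw → rel x sv₂ sw → sv₁ = sv₂
  frame : ∃ φ : W.U → V.U, ∀ {x : X} {sv : V.St} {sw : W.St} {p : W.U}, rel x sv (sw.otherFrame p) →
    ∃ sv' : V.St, sv = sv'.otherFrame (φ p) ∧ rel x (sv'.selfFrame (φ p)) (sw.selfFrame p)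
  other_fixed : ∀ {x x' : X} {sv sv' : V.St} {sw sw' : W.St}, rel x sv sw → rel x' sv' sw' →
    sw.other = sw'.other → sv.other = sv'.other
  index_inj : ∀ {x₁ x₂ sv sw₁ sw₂}, rel x₁ sv sw₁ → rel x₂ sv sw₂ → x₁ = x₂

/-- The action of a family, at an index, on predicates over states. -/
def Family.lift {V W : Resource Val} {X : Type} (f : Family V W X) (x : X) (P : V.St → Prop) :
    W.St → Prop :=
  fun sw => ∃ sv, f.rel x sv sw ∧ P sv

/-! ## Action trees and their operational semantics -/

/-- `A`-returning action trees over the resource `V`. -/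
inductive Tree : Resource Val → Type → Type 1
  | unfinished {V : Resource Val} {A : Type} : Tree V A
  | ret {V : Resource Val} {A : Type} (v : A) : Tree V A
  | act {V : Resource Val} {A : Type} (a : Action V A) : Tree V A
  | seq {V : Resource Val} {A B : Type} (T : Tree V B) (K : B → Tree V A) : Tree V A
  | par {V : Resource Val} {A B₁ B₂ : Type} (T₁ : Tree V B₁) (T₂ : Tree V B₂)
      (K : B₁ × B₂ → Tree V A) : Tree V A
  | morph {W V : Resource Val} {X A : Type} (f : Family W V X) (x : X) (T : Tree W A) : Tree V A

/-- Morphism contexts of resource type `V → W`: the outermost family comes first. -/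
inductive Ctx (V : Resource Val) : Resource Val → Type 1
  | nil : Ctx V V
  | cons {V₁ W : Resource Val} {X : Type} (f : Family V₁ W X) (Δ : Ctx V V₁) : Ctx V W

namespace Ctx

/-- The type of index tuples of a morphism context. -/
@[reducible] def Idx {V : Resource Val} : {W : Resource Val} → Ctx V W → Type
  | _, nil => Unit
  | _, cons (X := X) _ Δ => X × Idx Δ

/-- Extending a context by an innermost family. -/
def snoc {V V' : Resource Val} {X : Type} :
    {W : Resource Val} → Ctx V W → Family V' V X → Ctx V' W
  | _, nil, f => cons f nil
  | _, cons g Δ, f => cons g (snoc Δ f)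

/-- Extending an index tuple by an innermost index. -/
def snocIdx {V V' : Resource Val} {X : Type} :
    {W : Resource Val} → (Δ : Ctx V W) → (f : Family V' V X) → Δ.Idx → X → (Δ.snoc f).Idx
  | _, nil, _, _, y => (y, ())
  | _, cons (X := Y) _ Δ, f, xs, y =>
      let xs : Y × Δ.Idx := xs
      (xs.1, snocIdx Δ f xs.2 y)

/-- The image of an internal transition under all the families of a context. -/
def apply {V : Resource Val} : {W : Resource Val} → (Δ : Ctx V W) → Δ.Idx → V.int → W.int
  | _, nil, _, t => t
  | _, cons (X := Y) f Δ, xs, t =>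
      let xs : Y × Δ.Idx := xs
      f.trans xs.1 (apply Δ xs.2 t)

/-- `Δ.unwind t xs s xs' s'`: under the context `Δ`, the transition `t` steps from the state `s`
with the indices `xs` to the state `s'` with the indices `xs'`. -/
def unwind {V : Resource Val} :
    {W : Resource Val} → (Δ : Ctx V W) → V.int → Δ.Idx → W.St → Δ.Idx → W.St → Prop
  | _, nil, t, _, s, _, s' => t.1 s s'
  | _, cons (X := Y) f Δ, t, xs, s, xs', s' =>
      let ys : Y × Δ.Idx := xs
      let ys' : Y × Δ.Idx := xs'
      ((cons f Δ).apply xs t).1 s s' ∧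
        ∃ s₁ s₁', f.rel ys.1 s₁ s ∧ unwind Δ t ys.2 s₁ ys'.2 s₁' ∧ f.rel ys'.1 s₁' s'

end Ctx

/-- Paths, which identify the position of a reduction in a tree. -/
inductive Path
  | choiceAct
  | seqRet
  | seqStep (π : Path)
  | parRet
  | parL (π : Path)
  | parR (π : Path)
  | morphRet
  | morphStep (π : Path)

/-- `Step Δ xs s T π xs' s' T'` is the small-step judgment `Δ ⊢ xs, s, T →π xs', s', T'`. -/
inductive Step : {V W : Resource Val} → {A : Type} → (Δ : Ctx V W) →
    Δ.Idx → W.St → Tree V A → Path → Δ.Idx → W.St → Tree V A → Prop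
  | choiceAct {V W : Resource Val} {A : Type} {Δ : Ctx V W} {xs xs' : Δ.Idx} {s s' : W.St}
      {a : Action V A} {v : A} (h : Δ.unwind (a.rel v) xs s xs' s') :
      Step Δ xs s (.act a) .choiceAct xs' s' (.ret v)
  | seqRet {V W : Resource Val} {A B : Type} {Δ : Ctx V W} {xs : Δ.Idx} {s : W.St}
      {v : B} {K : B → Tree V A} :
      Step Δ xs s (.seq (.ret v) K) .seqRet xs s (K v)
  | seqStep {V W : Resource Val} {A B : Type} {Δ : Ctx V W} {xs xs' : Δ.Idx} {s s' : W.St}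
      {T T' : Tree V B} {K : B → Tree V A} {π : Path} (h : Step Δ xs s T π xs' s' T') :
      Step Δ xs s (.seq T K) (.seqStep π) xs' s' (.seq T' K)
  | parRet {V W : Resource Val} {A B₁ B₂ : Type} {Δ : Ctx V W} {xs : Δ.Idx} {s : W.St}
      {v₁ : B₁} {v₂ : B₂} {K : B₁ × B₂ → Tree V A} :
      Step Δ xs s (.par (.ret v₁) (.ret v₂) K) .parRet xs s (K (v₁, v₂))
  | parL {V W : Resource Val} {A B₁ B₂ : Type} {Δ : Ctx V W} {xs xs' : Δ.Idx} {s s' : W.St}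
      {T₁ T₁' : Tree V B₁} {T₂ : Tree V B₂} {K : B₁ × B₂ → Tree V A} {π : Path}
      (h : Step Δ xs s T₁ π xs' s' T₁') :
      Step Δ xs s (.par T₁ T₂ K) (.parL π) xs' s' (.par T₁' T₂ K)
  | parR {V W : Resource Val} {A B₁ B₂ : Type} {Δ : Ctx V W} {xs xs' : Δ.Idx} {s s' : W.St}
      {T₁ : Tree V B₁} {T₂ T₂' : Tree V B₂} {K : B₁ × B₂ → Tree V A} {π : Path}
      (h : Step Δ xs s T₂ π xs' s' T₂') :
      Step Δ xs s (.par T₁ T₂ K) (.parR π) xs' s' (.par T₁ T₂' K)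
  | morphRet {V V' W : Resource Val} {X A : Type} {Δ : Ctx V W} {xs : Δ.Idx} {s : W.St}
      {f : Family V' V X} {y : X} {v : A} :
      Step Δ xs s (.morph f y (.ret v)) .morphRet xs s (.ret v)
  | morphStep {V V' W : Resource Val} {X A : Type} {Δ : Ctx V W} {xs xs' : Δ.Idx} {s s' : W.St}
      {f : Family V' V X} {y y' : X} {T T' : Tree V' A} {π : Path}
      (h : Step (Δ.snoc f) (Δ.snocIdx f xs y) s T π (Δ.snocIdx f xs' y') s' T') :
      Step Δ xs s (.morph f y T) (.morphStep π) xs' s' (.morph f y' T')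

/-- Good (well-formed) paths of a tree. -/
inductive Good : {V : Resource Val} → {A : Type} → Tree V A → Path → Prop
  | choiceAct {V : Resource Val} {A : Type} {a : Action V A} : Good (.act a) .choiceAct
  | seqRet {V : Resource Val} {A B : Type} {v : B} {K : B → Tree V A} :
      Good (.seq (.ret v) K) .seqRet
  | seqStep {V : Resource Val} {A B : Type} {T : Tree V B} {K : B → Tree V A} {π : Path}
      (h : Good T π) : Good (.seq T K) (.seqStep π)
  | parRet {V : Resource Val} {A B₁ B₂ : Type} {v₁ : B₁} {v₂ : B₂} {K : B₁ × B₂ → Tree V A} :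
      Good (.par (.ret v₁) (.ret v₂) K) .parRet
  | parL {V : Resource Val} {A B₁ B₂ : Type} {T₁ : Tree V B₁} {T₂ : Tree V B₂}
      {K : B₁ × B₂ → Tree V A} {π : Path} (h : Good T₁ π) : Good (.par T₁ T₂ K) (.parL π)
  | parR {V : Resource Val} {A B₁ B₂ : Type} {T₁ : Tree V B₁} {T₂ : Tree V B₂}
      {K : B₁ × B₂ → Tree V A} {π : Path} (h : Good T₂ π) : Good (.par T₁ T₂ K) (.parR π)
  | morphRet {V V' : Resource Val} {X A : Type} {f : Family V' V X} {y : X} {v : A} :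
      Good (.morph f y (.ret v)) .morphRet
  | morphStep {V V' : Resource Val} {X A : Type} {f : Family V' V X} {y : X} {T : Tree V' A}
      {π : Path} (h : Good T π) : Good (.morph f y T) (.morphStep π)

/-- Steps in the empty morphism context. -/
def Step₀ {V : Resource Val} {A : Type} (s : V.St) (T : Tree V A) (π : Path) (s' : V.St)
    (T' : Tree V A) : Prop :=
  Step Ctx.nil () s T π () s' T'

/-- The state `s` is safe for the tree `T` and the path `π`. -/
def Safe {V : Resource Val} {A : Type} (T : Tree V A) (π : Path) (s : V.St) : Prop :=
  Good T π → ∃ s' T', Step₀ s T π s' T'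

/-! ## Predicate transformers, programs and Hoare triples -/

/-- Along the path sequence, under any interference, the tree stays safe and the predicate `X`
holds of all intermediate states and trees. -/
def AlwaysAlong {V : Resource Val} {A : Type} (X : V.St → Tree V A → Prop) :
    List Path → Tree V A → V.St → Prop
  | [], T, s => ∀ s₂, OtherSteps V s s₂ → X s₂ T
  | π :: ζ, T, s => ∀ s₂, OtherSteps V s s₂ →
      Safe T π s₂ ∧ X s₂ T ∧ ∀ s₃ T', Step₀ s₂ T π s₃ T' → AlwaysAlong X ζ T' s₃

/-- `X` holds and safety is kept along all path sequences. -/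
def Always {V : Resource Val} {A : Type} (T : Tree V A) (X : V.St → Tree V A → Prop)
    (s : V.St) : Prop :=
  ∀ ζ, AlwaysAlong X ζ T s

/-- `T` is safe from `s` for any number of steps, and `Q` holds whenever it has terminated. -/
def After {V : Resource Val} {A : Type} (T : Tree V A) (Q : A → V.St → Prop) (s : V.St) : Prop :=
  Always T (fun s' T' => ∀ v, T' = .ret v → Q v s') s

/-- Programs over `V` that return values in `A`: sets of trees that contain `unfinished`. -/
def Prog (V : Resource Val) (A : Type) : Type 1 :=
  {e : Set (Tree V A) // Tree.unfinished ∈ e}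

/-- Lifting a program along a family, from an initial index. -/
def Prog.morph {V W : Resource Val} {X A : Type} (f : Family V W X) (x : X) (e : Prog V A) :
    Prog W A :=
  ⟨{Tree.unfinished} ∪ {T | ∃ T₁ ∈ e.1, T = Tree.morph f x T₁}, Or.inl rfl⟩

/-- From the valid state `s`, all the trees of `e` are safe and end in `Q`. -/
def Vrf {V : Resource Val} {A : Type} (e : Prog V A) (Q : A → V.St → Prop) (s : V.St) :
    Prop :=
  V.S s ∧ ∀ T ∈ e.1, After T Q s

/-- The Hoare triple `e : {P} A {Q}@V`. -/
def Triple {V : Resource Val} {A : Type} (P : V.St → Prop) (e : Prog V A)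
    (Q : A → V.St → Prop) : Prop :=
  ∀ s, V.S s → P s → Vrf e Q s

end Semantics

/-! ## The resource of private heaps -/

section Priv

variable (Val : Type)

/-- States `(σs, (), σo)` of private heaps. -/
abbrev PrivState : Type := State (Heap Val) Unit

variable {Val}

def privSpace (s : PrivState Val) : Prop := PCM.defined (s.self + s.other)

noncomputable def privFlat (s : PrivState Val) : Heap Val := s.self + s.other

/-- The private heap receives the heap `h` from the outside. -/
def privTake (h : Heap Val) (s s' : PrivState Val) : Prop :=
  privSpace s ∧ privSpace s' ∧ s'.self = h + s.self ∧ s'.other = s.other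

/-- The private heap gives the heap `h` away. -/
def privGive (h : Heap Val) (s s' : PrivState Val) : Prop :=
  privSpace s ∧ privSpace s' ∧ s.self = h + s'.self ∧ s'.other = s.other

theorem privSpace_global (s : PrivState Val) (p : Heap Val) :
    privSpace (s.selfFrame p) ↔ privSpace (s.otherFrame p) := by
  simp only [privSpace, State.selfFrame, State.otherFrame, add_assoc]

theorem privTake_transition (h : Heap Val) : IsTransition privSpace (privTake h) where
  functional := by
    rintro s s₁ s₂ ⟨-, -, h₁, k₁⟩ ⟨-, -, h₂, k₂⟩
    exact State.ext (h₁.trans h₂.symm) rfl (k₁.trans k₂.symm)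
  other_fixed := by
    rintro s s' ⟨-, -, -, k⟩
    exact k.symm
  locality := by
    rintro s p s' ⟨hs, hs', e, k⟩
    have e₁ : s' = State.otherFrame ⟨h + s.self, (), s.other⟩ p := State.ext e rfl k
    refine ⟨⟨h + s.self, (), s.other⟩, e₁, (privSpace_global s p).2 hs, ?_, ?_, rfl⟩
    · rw [e₁] at hs'
      exact (privSpace_global _ p).2 hs'
    · exact add_assoc _ _ _
  preserves := fun k _ => k.2.1

theorem privGive_transition (h : Heap Val) : IsTransition privSpace (privGive h) where
  functional := by
    rintro s s₁ s₂ ⟨hs, -, h₁, k₁⟩ ⟨-, -, h₂, k₂⟩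
    refine State.ext ?_ rfl (k₁.trans k₂.symm)
    refine PMap.add_left_cancel (x := h) ?_ (h₁.symm.trans h₂)
    rw [← h₁]
    exact PCM.defined_of_add hs
  other_fixed := by
    rintro s s' ⟨-, -, -, k⟩
    exact k.symm
  locality := by
    rintro s p s' ⟨hs, hs', e, k⟩
    have e₁ : s' = State.otherFrame ⟨s'.self, (), s.other⟩ p := State.ext rfl rfl k
    refine ⟨⟨s'.self, (), s.other⟩, e₁, (privSpace_global s p).2 hs, ?_, ?_, rfl⟩
    · rw [e₁] at hs'
      exact (privSpace_global _ p).2 hs'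
    · change s.self + p = h + (s'.self + p)
      rw [← add_assoc, ← e]
      rfl
  preserves := fun k _ => k.2.1

/-- The resource `Priv`. Its internal transitions are all the updates of the private heap that
are internal transitions of the state space, the idle ones included. -/
noncomputable def Priv (Val : Type) : Resource Val where
  U := Heap Val
  T := Unit
  S := privSpace
  valid := id
  global := privSpace_global
  flat := privFlat
  flat_defined := id
  flat_frame s p := by
    simp only [privFlat, State.selfFrame, State.otherFrame, add_assoc]
  int := {t | IsInternal privSpace privFlat t}
  int_internal _ ht := ht
  ext := {t | ∃ h, t = privTake h ∨ t = privGive h}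
  ext_transition := by
    rintro t ⟨h, rfl | rfl⟩
    · exact privTake_transition h
    · exact privGive_transition h

end Priv

/-! ## The resource of concurrent stacks with histories -/

section Stack

variable {Val : Type}

/-- Stack contents before and after a push or a pop. -/
def PushOrPop (α β : List ℕ) : Prop := ∃ v, β = v :: α ∨ α = v :: β

/-- `IsLog n τ α`: the history `τ` records, at the time-stamps `1, …, n` and without gaps,
consecutive pushes and pops that lead from the empty stack to the contents `α`. -/
inductive IsLog : ℕ → Hist → List ℕ → Prop
  | start : IsLog 0 0 []
  | op {n : ℕ} {τ : Hist} {α β : List ℕ} : IsLog n τ α → PushOrPop α β →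
      IsLog (n + 1) (τ + PMap.single (n + 1) (α, β)) β

/-- States `((σs, τs), (σj, α), (σo, τo))` of the stack. -/
abbrev StackState (Val : Type) : Type := State (Heap Val × Hist) (Heap Val × List ℕ)

noncomputable def stackFlat (s : StackState Val) : Heap Val := s.self.1 + s.joint.1 + s.other.1

def stackSpace (layout : List ℕ → Heap Val → Prop) (s : StackState Val) : Prop :=
  PCM.defined (stackFlat s) ∧ layout s.joint.2 s.joint.1 ∧
    ∃ n, IsLog n (s.self.2 + s.other.2) s.joint.2

/-- Steps that change nothing but the private heap of the thread. -/
def PrivateStep (s s' : StackState Val) : Prop := s'.self.2 = s.self.2 ∧ s'.joint = s.joint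

/-- Steps that either keep the abstract contents and the history, or push or pop one element and
record this at one more time-stamp of the thread's own history. -/
def StackStep (s s' : StackState Val) : Prop :=
  (s'.self.2 = s.self.2 ∧ s'.joint.2 = s.joint.2) ∨
    (PushOrPop s.joint.2 s'.joint.2 ∧
      ∃ t, s'.self.2 = s.self.2 + PMap.single t (s.joint.2, s'.joint.2))

/-- The private heap of the thread receives the heap `h` from the outside. -/
def stackTake (layout : List ℕ → Heap Val → Prop) (h : Heap Val) (s s' : StackState Val) : Prop :=
  stackSpace layout s ∧ stackSpace layout s' ∧ s'.self.1 = h + s.self.1 ∧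
    PrivateStep s s' ∧ s'.other = s.other

/-- The private heap of the thread gives the heap `h` away. -/
def stackGive (layout : List ℕ → Heap Val → Prop) (h : Heap Val) (s s' : StackState Val) : Prop :=
  stackSpace layout s ∧ stackSpace layout s' ∧ s.self.1 = h + s'.self.1 ∧
    PrivateStep s s' ∧ s'.other = s.other

theorem stackFlat_frame (s : StackState Val) (p : Heap Val × Hist) :
    stackFlat (s.selfFrame p) = stackFlat (s.otherFrame p) := by
  simp only [stackFlat, State.selfFrame, State.otherFrame, Prod.fst_add]
  abel

theorem stackSpace_global (layout : List ℕ → Heap Val → Prop) (s : StackState Val)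
    (p : Heap Val × Hist) :
    stackSpace layout (s.selfFrame p) ↔ stackSpace layout (s.otherFrame p) := by
  unfold stackSpace
  rw [stackFlat_frame]
  simp only [State.selfFrame, State.otherFrame, Prod.snd_add, add_assoc]

theorem IsLog.defined {n : ℕ} {τ : Hist} {α : List ℕ} (h : IsLog n τ α) :
    PCM.defined τ ∧ ∀ k ∈ τ.dom, k ≤ n := by
  induction h with
  | start => exact ⟨PCM.defined_zero, fun k hk => absurd hk Finmap.notMem_empty⟩
  | @op n τ α β _ _ ih =>
    obtain ⟨hd, hk⟩ := ih
    cases τ with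
    | undef => exact absurd rfl hd
    | map m =>
      have hm : m.Disjoint (Finmap.singleton (n + 1) (α, β)) := by
        intro k h₁ h₂
        have := hk k h₁
        rw [Finmap.mem_singleton] at h₂
        omega
      have e : PMap.map m + PMap.single (n + 1) (α, β)
          = PMap.map (m ∪ Finmap.singleton (n + 1) (α, β)) := PMap.join_map hm
      rw [e]
      refine ⟨fun h => (by cases h), fun k hk' => ?_⟩
      rcases Finmap.mem_union.1 hk' with h | h
      · exact (hk k h).trans (Nat.le_succ n)
      · exact ((Finmap.mem_singleton _ _ _).1 h).le

theorem stackTake_transition (layout : List ℕ → Heap Val → Prop) (h : Heap Val) :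
    IsTransition (stackSpace layout) (stackTake layout h) where
  functional := by
    rintro s s₁ s₂ ⟨-, -, h₁, ⟨a₁, b₁⟩, k₁⟩ ⟨-, -, h₂, ⟨a₂, b₂⟩, k₂⟩
    exact State.ext (Prod.ext (h₁.trans h₂.symm) (a₁.trans a₂.symm)) (b₁.trans b₂.symm)
      (k₁.trans k₂.symm)
  other_fixed := by
    rintro s s' ⟨-, -, -, -, k⟩
    exact k.symm
  locality := by
    rintro s p s' ⟨hs, hs', e, ⟨a, b⟩, k⟩
    have e₁ : s' = State.otherFrame ⟨(h + s.self.1, s.self.2), s.joint, s.other⟩ p :=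
      State.ext (Prod.ext e a) b k
    refine ⟨⟨(h + s.self.1, s.self.2), s.joint, s.other⟩, e₁,
      (stackSpace_global layout s p).2 hs, ?_, ?_, ⟨rfl, rfl⟩, rfl⟩
    · rw [e₁] at hs'
      exact (stackSpace_global layout _ p).2 hs'
    · exact add_assoc _ _ _
  preserves := fun k _ => k.2.1

theorem stackGive_transition (layout : List ℕ → Heap Val → Prop) (h : Heap Val) :
    IsTransition (stackSpace layout) (stackGive layout h) where
  functional := by
    rintro s s₁ s₂ ⟨hs, -, h₁, ⟨a₁, b₁⟩, k₁⟩ ⟨-, -, h₂, ⟨a₂, b₂⟩, k₂⟩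
    refine State.ext (Prod.ext ?_ (a₁.trans a₂.symm)) (b₁.trans b₂.symm) (k₁.trans k₂.symm)
    refine PMap.add_left_cancel (x := h) ?_ (h₁.symm.trans h₂)
    rw [← h₁]
    exact PCM.defined_of_add (PCM.defined_of_add hs.1)
  other_fixed := by
    rintro s s' ⟨-, -, -, -, k⟩
    exact k.symm
  locality := by
    rintro s p s' ⟨hs, hs', e, ⟨a, b⟩, k⟩
    have e₁ : s' = State.otherFrame ⟨(s'.self.1, s.self.2), s.joint, s.other⟩ p :=
      State.ext (Prod.ext rfl a) b k
    refine ⟨⟨(s'.self.1, s.self.2), s.joint, s.other⟩, e₁,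
      (stackSpace_global layout s p).2 hs, ?_, ?_, ⟨rfl, rfl⟩, rfl⟩
    · rw [e₁] at hs'
      exact (stackSpace_global layout _ p).2 hs'
    · change s.self.1 + p.1 = h + (s'.self.1 + p.1)
      rw [← add_assoc, ← e]
      rfl
  preserves := fun k _ => k.2.1

/-- The resource `Stack`, for the predicate `layout` that lays out the contents in the joint heap
and the set `ops` of the implementation's operations on the shared stack. Its internal
transitions are those which update only the private heap of the thread (the idle ones included)
and those in `ops` that follow the protocol of the stack. -/
noncomputable def Stack (layout : List ℕ → Heap Val → Prop) (ops : Set (StateRel (Heap Val × Hist)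
    (Heap Val × List ℕ))) : Resource Val where
  U := Heap Val × Hist
  T := Heap Val × List ℕ
  S := stackSpace layout
  valid := by
    rintro s ⟨hd, -, n, hl⟩
    refine ⟨PCM.defined_of_add (y := s.joint.1) ?_, hl.defined.1⟩
    have e : s.self.1 + s.other.1 + s.joint.1 = stackFlat s := by
      simp only [stackFlat]
      abel
    change PCM.defined (s.self.1 + s.other.1 + s.joint.1)
    rw [e]
    exact hd
  global := stackSpace_global layout
  flat := stackFlat
  flat_defined h := h.1
  flat_frame := stackFlat_frame
  int := {t | IsInternal (stackSpace layout) stackFlat t ∧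
    ((∀ s s', t s s' → PrivateStep s s') ∨ (t ∈ ops ∧ ∀ s s', t s s' → StackStep s s'))}
  int_internal _ ht := ht.1
  ext := {t | ∃ h, t = stackTake layout h ∨ t = stackGive layout h}
  ext_transition := by
    rintro t ⟨h, rfl | rfl⟩
    · exact stackTake_transition layout h
    · exact stackGive_transition layout h

/-- The history-indexed state relation `(s_Priv, s_Stack) ∈ f τ` of quiescence. -/
def quiescentRel (layout : List ℕ → Heap Val → Prop) (τ : Hist) (sv : StackState Val)
    (sw : PrivState Val) : Prop :=
  stackSpace layout sv ∧ privSpace sw ∧ sw.self = sv.self.1 + sv.joint.1 ∧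
    sw.other = sv.other.1 ∧ sv.self.2 = τ ∧ sv.other.2 = 0

/-- Precondition of the history specification of `push(1) ∥ push(2)`. -/
def histPre (s : StackState Val) : Prop := s.self.1 = 0 ∧ s.self.2 = 0

/-- Postcondition of the history specification of `push(1) ∥ push(2)`. -/
def histPost (s : StackState Val) : Prop :=
  s.self.1 = 0 ∧ ∃ t₁ vs₁ t₂ vs₂,
    s.self.2 = PMap.single t₁ (vs₁, 1 :: vs₁) + PMap.single t₂ (vs₂, 2 :: vs₂)

end Stack

end FCSL

open FCSL

namespace FCSL

/-! ## Lifting of steps and triples along families -/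

section Lifting

variable {Val : Type}

/-! Part (i) rests on the fact that a `Priv` state determines the related `Stack` state at a given
index. The history `τ` is the whole log, since the others' part is empty. A log determines the
contents it leads to (`IsLog.unique`), precision then singles out the joint heap inside the private
one, and cancellation gives the rest. So the relation can be used to conjugate a stack transition
into a transition of private heaps; the flattenings of related states coincide, hence domains are
still preserved. Interference on private heaps alters only the other heap, and the stack imitates it
by external transitions: the environment gives its old heap away and takes the new one.

Part (ii) is a simulation argument valid for every family. `Step.lift` pushes a step of the source
tree up to the target, which yields safety; `Step.restrict` pulls a step of the lifted tree back
down, which yields the postcondition. Together they give `After.morph` and the lifting rule.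

The history-free specification follows by consequence. A private heap holding an empty stack is read
as the joint heap of a fresh stack. At the end the complete log consists of the two recorded pushes,
so their time-stamps are `1` and `2` and the contents depend only on the order (`IsLog.two_pushes`).
-/

/-- Extracts the outermost transition of an unwinding, the one to which `sim_int` of a further
family applies. -/
theorem Ctx.unwind.apply_rel {V W : Resource Val} {Δ : Ctx V W} {t : V.int} {xs xs' : Δ.Idx}
    {s s' : W.St} (h : Δ.unwind t xs s xs' s') : (Δ.apply xs t).1 s s' := by
  cases Δ with
  | nil => exact h
  | cons f Δ => exact h.1

/-- A step over the source of a family is simulated under the context extended by the family. -/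
theorem Step.lift {V W : Resource Val} {A : Type} {Δ : Ctx V W} {xs xs' : Δ.Idx}
    {s s' : W.St} {T T' : Tree V A} {π : Path} (h : Step Δ xs s T π xs' s' T') :
    ∀ {W' : Resource Val} {X : Type} (f : Family W W' X) (x : X) (sw : W'.St), f.rel x s sw →
      ∃ x' sw', f.rel x' s' sw' ∧
        Step (Ctx.cons f Δ) ((x, xs) : X × Δ.Idx) sw T π ((x', xs') : X × Δ.Idx) sw' T' := by
  induction h with
  | choiceAct h =>
    intro W' X f x sw hr
    obtain ⟨x', sw', ht, hr'⟩ := f.sim_int h.apply_rel hr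
    exact ⟨x', sw', hr', .choiceAct ⟨ht, _, _, hr, h, hr'⟩⟩
  | seqRet => exact fun f x sw hr => ⟨x, sw, hr, .seqRet⟩
  | parRet => exact fun f x sw hr => ⟨x, sw, hr, .parRet⟩
  | morphRet => exact fun f x sw hr => ⟨x, sw, hr, .morphRet⟩
  | seqStep _ ih =>
    intro W' X f x sw hr
    obtain ⟨x', sw', hr', h'⟩ := ih f x sw hr
    exact ⟨x', sw', hr', .seqStep h'⟩
  | parL _ ih =>
    intro W' X f x sw hr
    obtain ⟨x', sw', hr', h'⟩ := ih f x sw hr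
    exact ⟨x', sw', hr', .parL h'⟩
  | parR _ ih =>
    intro W' X f x sw hr
    obtain ⟨x', sw', hr', h'⟩ := ih f x sw hr
    exact ⟨x', sw', hr', .parR h'⟩
  | morphStep _ ih =>
    intro W' X f x sw hr
    obtain ⟨x', sw', hr', h'⟩ := ih f x sw hr
    exact ⟨x', sw', hr', .morphStep h'⟩

/-- A step under a context restricts to a step under the context without its outermost family. -/
def StepBelow {V : Resource Val} {A : Type} :
    {W : Resource Val} → (Δ : Ctx V W) → Δ.Idx → W.St → Tree V A → Path → Δ.Idx → W.St →
      Tree V A → Prop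
  | _, .nil, _, _, _, _, _, _, _ => True
  | _, .cons (X := X) f Δ, xs, sw, T, π, xs', sw', T' =>
      let ys : X × Δ.Idx := xs
      let ys' : X × Δ.Idx := xs'
      ∀ s, f.rel ys.1 s sw → ∃ s', f.rel ys'.1 s' sw' ∧ Step Δ ys.2 s T π ys'.2 s' T'

/-- Unwinding through the outermost family already contains a step below it, starting from some
related state; functionality of the family identifies that state with the given one. Stating this by
`StepBelow` keeps the context a variable, so that induction passes under `morphStep`: there the
context grows at its inner end, while the family removed is at the outer end. -/
theorem Step.restrict {V W : Resource Val} {A : Type} {Δ : Ctx V W} {xs xs' : Δ.Idx}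
    {s s' : W.St} {T T' : Tree V A} {π : Path} (h : Step Δ xs s T π xs' s' T') :
    StepBelow Δ xs s T π xs' s' T' := by
  induction h with
  | @choiceAct V W A Δ xs xs' s s' a v h =>
    cases Δ with
    | nil => trivial
    | cons f Δ =>
      intro s₀ hr
      obtain ⟨-, s₁, s₁', h₁, h₂, h₃⟩ := h
      obtain rfl := f.functional hr h₁
      exact ⟨s₁', h₃, .choiceAct h₂⟩
  | @seqRet V W A B Δ =>
    cases Δ with
    | nil => trivial
    | cons f Δ => exact fun s₀ hr => ⟨s₀, hr, .seqRet⟩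
  | @parRet V W A B₁ B₂ Δ =>
    cases Δ with
    | nil => trivial
    | cons f Δ => exact fun s₀ hr => ⟨s₀, hr, .parRet⟩
  | @morphRet V V' W X A Δ =>
    cases Δ with
    | nil => trivial
    | cons f Δ => exact fun s₀ hr => ⟨s₀, hr, .morphRet⟩
  | @seqStep V W A B Δ xs xs' s s' T T' K π h ih =>
    cases Δ with
    | nil => trivial
    | cons f Δ =>
      intro s₀ hr
      obtain ⟨s₁, hr', h'⟩ := ih s₀ hr
      exact ⟨s₁, hr', .seqStep h'⟩
  | @parL V W A B₁ B₂ Δ xs xs' s s' T₁ T₁' T₂ K π h ih =>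
    cases Δ with
    | nil => trivial
    | cons f Δ =>
      intro s₀ hr
      obtain ⟨s₁, hr', h'⟩ := ih s₀ hr
      exact ⟨s₁, hr', .parL h'⟩
  | @parR V W A B₁ B₂ Δ xs xs' s s' T₁ T₁' T₂ K π h ih =>
    cases Δ with
    | nil => trivial
    | cons f Δ =>
      intro s₀ hr
      obtain ⟨s₁, hr', h'⟩ := ih s₀ hr
      exact ⟨s₁, hr', .parR h'⟩
  | @morphStep V V' W X A Δ xs xs' s s' f y y' T T' π h ih =>
    cases Δ with
    | nil => trivial
    | cons f Δ =>
      intro s₀ hr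
      obtain ⟨s₁, hr', h'⟩ := ih s₀ hr
      exact ⟨s₁, hr', .morphStep h'⟩

/-! ### Safety and postconditions under interference -/

variable {V W : Resource Val} {A X : Type}

theorem not_good_ret {v : A} {π : Path} : ¬ Good (.ret v : Tree V A) π := by
  intro h
  cases h

theorem not_good_unfinished {π : Path} : ¬ Good (.unfinished : Tree V A) π := by
  intro h
  cases h

theorem not_step_ret {v : A} {π : Path} {s s' : V.St} {T' : Tree V A} :
    ¬ Step₀ s (.ret v) π s' T' := by
  intro h
  cases h

theorem not_step_unfinished {π : Path} {s s' : V.St} {T' : Tree V A} :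
    ¬ Step₀ s .unfinished π s' T' := by
  intro h
  cases h

/-- With no good path and no step, only interference remains. This covers `ret` and `unfinished`. -/
theorem always_of_stuck {T : Tree V A} {Y : V.St → Tree V A → Prop} {s : V.St}
    (hg : ∀ π, ¬ Good T π) (hs : ∀ s π s' T', ¬ Step₀ s T π s' T')
    (hY : ∀ s', OtherSteps V s s' → Y s' T) : Always T Y s := by
  intro ζ
  cases ζ with
  | nil => exact hY
  | cons π ζ =>
    exact fun s₂ h₂ => ⟨fun h => absurd h (hg π), hY s₂ h₂, fun s₃ T' h => absurd h (hs _ _ _ _)⟩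

theorem after_unfinished (Q : A → V.St → Prop) (s : V.St) : After .unfinished Q s :=
  always_of_stuck (fun _ => not_good_unfinished) (fun _ _ _ _ => not_step_unfinished)
    (fun _ _ v h => by cases h)

theorem Always.otherSteps {T : Tree V A} {Y : V.St → Tree V A → Prop} {s s' : V.St}
    (h : Always T Y s) (hs : OtherSteps V s s') : Always T Y s' := by
  intro ζ
  have := h ζ
  cases ζ with
  | nil => exact fun s₂ h₂ => this s₂ (hs.trans h₂)
  | cons π ζ => exact fun s₂ h₂ => this s₂ (hs.trans h₂)

theorem Always.step {T T' : Tree V A} {Y : V.St → Tree V A → Prop} {s s' : V.St} {π : Path}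
    (h : Always T Y s) (hs : Step₀ s T π s' T') : Always T' Y s' :=
  fun ζ => (h (π :: ζ) s .refl).2.2 s' T' hs

theorem Always.safe {T : Tree V A} {Y : V.St → Tree V A → Prop} {s : V.St}
    (h : Always T Y s) (π : Path) : Safe T π s :=
  (h [π] s .refl).1

theorem Always.now {T : Tree V A} {Y : V.St → Tree V A → Prop} {s : V.St}
    (h : Always T Y s) : Y s T :=
  h [] s .refl

/-- Covers the moment after `morphRet`, when the family has gone from the tree but interference over
`W` continues. It is pulled back to `V` by `sim_other`, at the same index. -/
theorem after_ret_lift {f : Family V W X} {x : X} {v : A} {Q : A → V.St → Prop} {sv : V.St}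
    {sw : W.St} (hr : f.rel x sv sw) (h : After (.ret v) Q sv) :
    After (.ret v) (fun v sw => ∃ x, f.lift x (Q v) sw) sw := by
  refine always_of_stuck (fun _ => not_good_ret) (fun _ _ _ _ => not_step_ret) ?_
  rintro s' hs' w ⟨⟩
  obtain ⟨sv', hsv', hr'⟩ := f.sim_other hs' hr
  exact ⟨x, sv', hr', (h.otherSteps hsv').now v rfl⟩

/-- The invariant of the induction on path sequences is that the current `W` state is related, at
the index stored in the tree, to a `V` state from which `T` still satisfies `After`. The final index
is forgotten by `morphRet`, hence the existential in the postcondition. -/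
theorem After.morph {f : Family V W X} {Q : A → V.St → Prop} {x : X} {T : Tree V A}
    {sv : V.St} {sw : W.St} (hr : f.rel x sv sw) (h : After T Q sv) :
    After (.morph f x T) (fun v sw => ∃ x, f.lift x (Q v) sw) sw := by
  intro ζ
  induction ζ generalizing x T sv sw with
  | nil => exact fun s₂ _ v hv => by cases hv
  | cons π ζ ih =>
    intro s₂ hs₂
    obtain ⟨sv₂, hsv₂, hr₂⟩ := f.sim_other hs₂ hr
    have h₂ : After T Q sv₂ := h.otherSteps hsv₂
    refine ⟨fun hg => ?_, fun v hv => (by cases hv), fun s₃ T' hst => ?_⟩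
    · cases hg with
      | morphRet => exact ⟨_, _, .morphRet⟩
      | morphStep hg =>
        obtain ⟨sv', T', hst⟩ := h₂.safe _ hg
        obtain ⟨x', sw', -, hst'⟩ := Step.lift hst f x s₂ hr₂
        -- Extending the empty context at the inner or the outer end gives the same context by
        -- computation; `morphStep` expects the inner form.
        have hm : Step (Ctx.nil.snoc f) (Ctx.nil.snocIdx f () x) s₂ T _ (Ctx.nil.snocIdx f () x')
          sw' T' := hst'
        exact ⟨sw', .morph f x' T', .morphStep hm⟩
    · unfold Step₀ at hst
      cases hst with
      | morphRet => exact after_ret_lift hr₂ h₂ ζ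
      | morphStep hst =>
        obtain ⟨sv₃, hr₃, hst'⟩ := hst.restrict sv₂ hr₂
        exact ih hr₃ (h₂.step hst')

/-- The lifting rule for indexed families. -/
theorem Triple.morph {f : Family V W X} {x : X} {P : V.St → Prop} {Q : A → V.St → Prop}
    {e : Prog V A} (h : Triple P e Q) :
    Triple (f.lift x P) (e.morph f x) (fun v s => ∃ x, f.lift x (Q v) s) := by
  rintro s hs ⟨sv, hr, hP⟩
  refine ⟨hs, ?_⟩
  rintro T (rfl | ⟨T₁, hT₁, rfl⟩)
  · exact after_unfinished _ _
  · exact After.morph hr ((h sv (f.rel_space hr).1 hP).2 T₁ hT₁)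

theorem After.mono {T : Tree V A} {Q Q' : A → V.St → Prop} {s : V.St} (hQ : ∀ v s, Q v s → Q' v s)
    (h : After T Q s) : After T Q' s := by
  intro ζ
  induction ζ generalizing T s with
  | nil => exact fun s₂ h₂ v hv => hQ v s₂ (h [] s₂ h₂ v hv)
  | cons π ζ ih =>
    intro s₂ h₂
    have h' : After T Q s₂ := h.otherSteps h₂
    exact ⟨h'.safe π, fun v hv => hQ v s₂ (h'.now v hv), fun s₃ T' hst => ih (h'.step hst)⟩

/-- The rule of consequence. -/
theorem Triple.conseq {P P' : V.St → Prop} {e : Prog V A} {Q Q' : A → V.St → Prop}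
    (h : Triple P e Q) (hP : ∀ s, V.S s → P' s → P s) (hQ : ∀ v s, Q v s → Q' v s) :
    Triple P' e Q' :=
  fun s hs hp => ⟨hs, fun T hT => ((h s hs (hP s hs hp)).2 T hT).mono hQ⟩

end Lifting

/-! ## Entries of logs -/

namespace PMap

variable {K V : Type} [DecidableEq K]

/-- The value at a key. -/
def get : PMap K V → K → Option V
  | map m, k => m.lookup k
  | undef, _ => none

theorem get_zero (k : K) : get (0 : PMap K V) k = none := Finmap.lookup_empty k

theorem get_single (k : K) (v : V) : get (single k v) k = some v :=
  Finmap.lookup_singleton_eq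

theorem get_single_ne {k l : K} (h : l ≠ k) (v : V) : get (single k v) l = none :=
  Finmap.lookup_eq_none.2 fun hl => h ((Finmap.mem_singleton _ _ _).1 hl)

theorem get_add {x y : PMap K V} (h : PCM.defined (x + y)) (k : K) :
    get (x + y) k = (get x k).or (get y k) := by
  change join x y ≠ undef at h
  change get (join x y) k = _
  rcases x with _ | a
  · exact absurd (undef_join y) h
  rcases y with _ | b
  · exact absurd (join_undef _) h
  by_cases hab : a.Disjoint b
  · rw [join_map hab]
    simp only [get]
    by_cases hk : k ∈ a
    · rw [Finmap.lookup_union_left hk]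
      obtain ⟨v, hv⟩ := Finmap.mem_iff.1 hk
      rw [hv, Option.some_or]
    · rw [Finmap.lookup_union_right hk, Finmap.lookup_eq_none.2 hk, Option.none_or]
  · exact absurd (join_map_of_not hab) h

theorem not_defined_single_add (k : K) (v w : V) :
    ¬ PCM.defined (single k v + single k w) := by
  intro h
  refine h (join_map_of_not fun hd => hd k ?_ ?_) <;> exact (Finmap.mem_singleton _ _ _).2 rfl

end PMap

/-! ### What the entries of a log determine -/

section Log

open PMap

theorem IsLog.get_eq_none {n : ℕ} {τ : Hist} {α : List ℕ} (h : IsLog n τ α) {k : ℕ}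
    (hk : k = 0 ∨ n < k) : get τ k = none := by
  induction h with
  | start => exact get_zero k
  | @op n τ α β hl hp ih =>
    rw [get_add (IsLog.op hl hp).defined.1, ih (by omega), get_single_ne (by omega),
      Option.none_or]

theorem IsLog.get_last {n : ℕ} {τ : Hist} {α β : List ℕ} (h : IsLog n τ α)
    (hp : PushOrPop α β) :
    get (τ + single (n + 1) (α, β)) (n + 1) = some (α, β) := by
  rw [get_add (IsLog.op h hp).defined.1, h.get_eq_none (by omega), get_single, Option.none_or]

theorem IsLog.get_of_le {n : ℕ} {τ : Hist} {α β : List ℕ} (h : IsLog n τ α)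
    (hp : PushOrPop α β) {k : ℕ} (hk : k ≤ n) :
    get (τ + single (n + 1) (α, β)) k = get τ k := by
  rw [get_add (IsLog.op h hp).defined.1, get_single_ne (by omega), Option.or_none]

/-- Each operation fills exactly the next time-stamp, so the domain is the interval from `1` to `n`;
in particular a history fixes the length of its log. -/
theorem IsLog.get_isSome {n : ℕ} {τ : Hist} {α : List ℕ} (h : IsLog n τ α) (k : ℕ) :
    (get τ k).isSome ↔ 1 ≤ k ∧ k ≤ n := by
  induction h with
  | start => rw [get_zero]; simp; omega
  | @op n τ α β hl hp ih =>
    rcases Nat.lt_or_ge n k with hk | hk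
    · by_cases hk' : k = n + 1
      · subst hk'
        simp [hl.get_last hp]
      · rw [(IsLog.op hl hp).get_eq_none (by omega)]
        simp
        omega
    · rw [hl.get_of_le hp hk, ih]
      omega

theorem IsLog.last {n : ℕ} {τ : Hist} {α : List ℕ} (h : IsLog n τ α) :
    (n = 0 ∧ α = []) ∨ (n ≠ 0 ∧ ∃ γ, get τ n = some (γ, α)) := by
  cases h with
  | start => exact Or.inl ⟨rfl, rfl⟩
  | op hl hp => exact Or.inr ⟨Nat.succ_ne_zero _, _, hl.get_last hp⟩

/-- A log determines the contents it leads to. -/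
theorem IsLog.unique {n m : ℕ} {τ : Hist} {α β : List ℕ} (h₁ : IsLog n τ α)
    (h₂ : IsLog m τ β) : α = β := by
  have hnm : n = m := by
    -- The two intervals agree as sets; testing them at `n` and at `m` bounds each by the other.
    have e := fun k => (h₁.get_isSome k).symm.trans (h₂.get_isSome k)
    have e₁ := e n
    have e₂ := e m
    omega
  subst hnm
  rcases h₁.last with ⟨hn, hα⟩ | ⟨hn, γ, hγ⟩ <;> rcases h₂.last with ⟨hm, hβ⟩ | ⟨hm, δ, hδ⟩
  · rw [hα, hβ]
  · exact absurd hn hm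
  · exact absurd hm hn
  · rw [hγ] at hδ
    exact congrArg Prod.snd (Option.some.inj hδ)

/-- A log with precisely two entries, which push `1` and `2`. -/
theorem IsLog.two_pushes {n : ℕ} {α : List ℕ} {t₁ t₂ : ℕ} {vs₁ vs₂ : List ℕ}
    (h : IsLog n (single t₁ (vs₁, 1 :: vs₁) + single t₂ (vs₂, 2 :: vs₂)) α) :
    α = [1, 2] ∨ α = [2, 1] := by
  have hd := h.defined.1
  have hne : t₁ ≠ t₂ := by
    rintro rfl
    exact not_defined_single_add _ _ _ hd
  have g₁ : get (single t₁ (vs₁, 1 :: vs₁) + single t₂ (vs₂, 2 :: vs₂)) t₁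
      = some (vs₁, 1 :: vs₁) := by
    rw [get_add hd, get_single, Option.some_or]
  have g₂ : get (single t₁ (vs₁, 1 :: vs₁) + single t₂ (vs₂, 2 :: vs₂)) t₂
      = some (vs₂, 2 :: vs₂) := by
    rw [get_add hd, get_single, get_single_ne hne.symm, Option.none_or]
  have g₃ : ∀ k, k ≠ t₁ → k ≠ t₂ →
      get (single t₁ (vs₁, 1 :: vs₁) + single t₂ (vs₂, 2 :: vs₂)) k = none := by
    intro k h₁ h₂
    rw [get_add hd, get_single_ne h₁, get_single_ne h₂, Option.none_or]
  have b₁ := (h.get_isSome t₁).1 (by rw [g₁]; rfl)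
  have b₂ := (h.get_isSome t₂).1 (by rw [g₂]; rfl)
  have b₃ : ∀ k, 1 ≤ k → k ≤ n → k = t₁ ∨ k = t₂ := by
    intro k h₁ h₂
    by_contra hk
    rw [not_or] at hk
    have := (h.get_isSome k).2 ⟨h₁, h₂⟩
    rw [g₃ k hk.1 hk.2] at this
    cases this
  -- Two distinct time-stamps force `n ≥ 2`; if `n ≥ 3`, then `1`, `2`, `3` would all lie in `{t₁,
  -- t₂}`.
  have hn : n = 2 := by
    have c₁ := b₃ 1
    have c₂ := b₃ 2
    have c₃ := b₃ 3
    omega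
  subst hn
  -- With the history a variable, `cases` can peel the two operations off the log; its entries
  -- survive in `g₁` and `g₂`.
  generalize single t₁ (vs₁, 1 :: vs₁) + single t₂ (vs₂, 2 :: vs₂) = τ at *
  cases h with
  | op h hp =>
    have l₂ := h.get_last hp
    have l₁ := h.get_of_le hp (le_refl 1)
    cases h with
    | op h' hp' =>
      rw [h'.get_last hp'] at l₁
      cases h' with
      | start =>
        have ht : t₁ = 1 ∧ t₂ = 2 ∨ t₁ = 2 ∧ t₂ = 1 := by omega
        rcases ht with ⟨rfl, rfl⟩ | ⟨rfl, rfl⟩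
        · rw [g₁] at l₁
          rw [g₂] at l₂
          simp only [Option.some.injEq, Prod.mk.injEq] at l₁ l₂
          right
          rw [← l₂.2, l₂.1, ← l₁.2, l₁.1]
        · rw [g₂] at l₁
          rw [g₁] at l₂
          simp only [Option.some.injEq, Prod.mk.injEq] at l₁ l₂
          left
          rw [← l₂.2, l₂.1, ← l₁.2, l₁.1]

end Log

/-! ## Quiescence -/

section Quiescence

variable {Val : Type} {layout : List ℕ → Heap Val → Prop}

theorem quiescentRel.flat_eq {τ : Hist} {sv : StackState Val} {sw : PrivState Val}
    (h : quiescentRel layout τ sv sw) : privFlat sw = stackFlat sv := by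
  rw [privFlat, stackFlat, h.2.2.1, h.2.2.2.1]

/-- The self history is the index and the others' is empty, so both logs are logs of `τ` and have
equal contents. Precision inside the defined private heap gives equal joint heaps, and cancellation
gives equal private parts. -/
theorem quiescentRel.functional (hlayout : ∀ α, Precise (layout α)) {τ : Hist}
    {sv₁ sv₂ : StackState Val} {sw : PrivState Val} (h₁ : quiescentRel layout τ sv₁ sw)
    (h₂ : quiescentRel layout τ sv₂ sw) : sv₁ = sv₂ := by
  obtain ⟨⟨-, l₁, n₁, i₁⟩, hd, a₁, b₁, c₁, d₁⟩ := h₁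
  obtain ⟨⟨-, l₂, n₂, i₂⟩, -, a₂, b₂, c₂, d₂⟩ := h₂
  obtain ⟨⟨x₁, y₁⟩, ⟨j₁, α₁⟩, ⟨p₁, q₁⟩⟩ := sv₁
  obtain ⟨⟨x₂, y₂⟩, ⟨j₂, α₂⟩, ⟨p₂, q₂⟩⟩ := sv₂
  dsimp only at *
  subst c₁ d₁ c₂ d₂
  obtain rfl := i₁.unique i₂
  obtain rfl : p₁ = p₂ := b₁.symm.trans b₂
  have e : j₁ + x₁ = j₂ + x₂ := by rw [add_comm, ← a₁, a₂, add_comm]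
  have hd' : PCM.defined (j₁ + x₁) := by
    rw [add_comm, ← a₁]
    exact PCM.defined_of_add hd
  obtain rfl := hlayout _ _ _ _ _ hd' e l₁ l₂
  obtain rfl := PMap.add_left_cancel hd' e
  rfl

theorem quiescentRel.functional_right {τ τ' : Hist} {sv : StackState Val}
    {sw₁ sw₂ : PrivState Val} (h₁ : quiescentRel layout τ sv sw₁)
    (h₂ : quiescentRel layout τ' sv sw₂) : sw₁ = sw₂ :=
  State.ext (h₁.2.2.1.trans h₂.2.2.1.symm) rfl (h₁.2.2.2.1.trans h₂.2.2.2.1.symm)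

/-- The frame map is `p ↦ (p, 0)`: the environment has no history, so a heap moved from it carries
none. -/
theorem quiescentRel.frame {τ : Hist} {sv : StackState Val} {sw : PrivState Val} {p : Heap Val}
    (h : quiescentRel layout τ sv (sw.otherFrame p)) :
    ∃ sv' : StackState Val, sv = sv'.otherFrame (p, 0) ∧
      quiescentRel layout τ (sv'.selfFrame (p, 0)) (sw.selfFrame p) := by
  obtain ⟨hv, hw, a, b, c, d⟩ := h
  have e : sv = State.otherFrame ⟨sv.self, sv.joint, (sw.other, 0)⟩ (p, 0) :=
    State.ext rfl rfl (Prod.ext b.symm (d.trans (add_zero 0).symm))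
  refine ⟨⟨sv.self, sv.joint, (sw.other, 0)⟩, e, ?_, (privSpace_global _ _).2 hw, ?_, rfl, ?_, rfl⟩
  · rw [stackSpace_global, ← e]
    exact hv
  · change sw.self + p = sv.self.1 + p + sv.joint.1
    rw [show sw.self = sv.self.1 + sv.joint.1 from a]
    abel
  · change sv.self.2 + 0 = τ
    rw [add_zero, c]

/-- A valid stack state without history of the others is related to a state of private heaps. -/
theorem quiescentRel_of_stackSpace {sv : StackState Val} (h : stackSpace layout sv)
    (ho : sv.other.2 = 0) :
    quiescentRel layout sv.self.2 sv ⟨sv.self.1 + sv.joint.1, (), sv.other.1⟩ :=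
  ⟨h, h.1, rfl, rfl, rfl, ho⟩

/-- The image of a transition of the stack at a history. -/
def quiescentTrans (layout : List ℕ → Heap Val → Prop) (τ : Hist)
    (t : StateRel (Heap Val × Hist) (Heap Val × List ℕ)) (sw sw' : PrivState Val) : Prop :=
  ∃ sv sv' τ', quiescentRel layout τ sv sw ∧ t sv sv' ∧ quiescentRel layout τ' sv' sw'

/-- Functionality composes three determinations: the stack pre-state from the private one, its
successor under `t`, and the private post-state from that. Locality combines `quiescentRel.frame`
with locality of `t`. -/
theorem quiescentTrans_internal (hlayout : ∀ α, Precise (layout α)) (τ : Hist)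
    {t : StateRel (Heap Val × Hist) (Heap Val × List ℕ)}
    (ht : IsInternal (stackSpace layout) stackFlat t) :
    IsInternal privSpace privFlat (quiescentTrans layout τ t) where
  functional := by
    rintro s s₁ s₂ ⟨v₁, v₁', τ₁, r₁, h₁, r₁'⟩ ⟨v₂, v₂', τ₂, r₂, h₂, r₂'⟩
    obtain rfl := r₁.functional hlayout r₂
    obtain rfl := ht.functional h₁ h₂
    exact r₁'.functional_right r₂'
  other_fixed := by
    rintro s s' ⟨v, v', τ', r, h, r'⟩
    rw [r.2.2.2.1, r'.2.2.2.1, ht.other_fixed h]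
  locality := by
    rintro s p s' ⟨v, v', τ', r, h, r'⟩
    obtain ⟨v₀, rfl, r₀⟩ := r.frame
    obtain ⟨v₁, rfl, h₁⟩ := ht.locality h
    -- Read off the self-framed step, where `other` carries no frame and nothing has to be
    -- cancelled.
    have ho : v₀.other = v₁.other := by
      have := ht.other_fixed h₁
      exact this
    have ho₁ : s.other = v₁.other.1 := by
      rw [← ho]
      exact r₀.2.2.2.1
    obtain ⟨hv, hw, a, b, c, -⟩ := r'
    have e : s' = State.otherFrame ⟨s'.self, (), s.other⟩ p := by
      refine State.ext rfl rfl (b.trans ?_)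
      rw [ho₁]
      rfl
    refine ⟨⟨s'.self, (), s.other⟩, e, _, _, τ', r₀, h₁, (stackSpace_global _ _ _).2 hv, ?_, ?_,
      ho₁, ?_, ?_⟩
    · rw [privSpace_global, ← e]
      exact hw
    · change s'.self + p = v₁.self.1 + p + v₁.joint.1
      rw [a]
      change v₁.self.1 + v₁.joint.1 + p = v₁.self.1 + p + v₁.joint.1
      abel
    · exact (add_zero v₁.self.2).trans c
    · change v₁.other.2 = 0
      rw [← ho]
      exact r₀.2.2.2.2.2
  preserves := by
    rintro s s' ⟨v, v', τ', r, h, r'⟩ -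
    exact r'.2.1
  dom_eq := by
    rintro s s' ⟨v, v', τ', r, h, r'⟩
    rw [r.flat_eq, r'.flat_eq, ht.dom_eq h]

theorem quiescentRel.otherSteps {ops : Set (StateRel (Heap Val × Hist) (Heap Val × List ℕ))}
    {τ : Hist} {sv : StackState Val} {sw sw' : PrivState Val}
    (hs : OtherSteps (Priv Val) sw sw') (h : quiescentRel layout τ sv sw) :
    ∃ sv', OtherSteps (Stack layout ops) sv sv' ∧ quiescentRel layout τ sv' sw' := by
  induction hs with
  | refl => exact ⟨sv, .refl, h⟩
  | @tail b c _ hstep ih =>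
    obtain ⟨sv₁, hsv₁, hv, hw, a, b', c', d⟩ := ih
    obtain ⟨t, ht, htb⟩ := hstep
    have htr : IsTransition privSpace t :=
      ht.elim (fun h => ((Priv Val).int_internal t h).toIsTransition)
        ((Priv Val).ext_transition t)
    -- Interference acts on transposed states, so its fixed `other` is the thread's own heap.
    have hself : b.self = c.self := htr.other_fixed htb
    have hw' : PCM.defined (b.other + b.self) := by
      rw [add_comm]
      exact hw
    have hc : PCM.defined (c.self + c.other) := by
      have hc' : PCM.defined (c.other + c.self) := htr.preserves htb hw'
      rwa [add_comm] at hc'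
    -- The environment's view of the stack stays valid when its heap shrinks to any summand `z` of a
    -- compatible heap `x`. Taking `z` to be all of `x` or `0` validates the endpoints of both
    -- external steps below.
    have hflat : ∀ x : Heap Val, PCM.defined (sv₁.self.1 + sv₁.joint.1 + x) →
        ∀ y z : Heap Val, x = y + z → stackSpace layout ⟨(z, 0), sv₁.joint, sv₁.self⟩ := by
      rintro _ hx y z rfl
      refine ⟨?_, hv.2.1, ?_⟩
      · refine PCM.defined_of_add (y := y) ?_
        convert hx using 1
        simp only [stackFlat]
        abel
      · obtain ⟨n, hn⟩ := hv.2.2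
        exact ⟨n, by rw [d, add_zero] at hn; rwa [← zero_add sv₁.self.2] at hn⟩
    have hb₁ : PCM.defined (sv₁.self.1 + sv₁.joint.1 + b.other) := by
      rw [← a]
      exact hw
    have hc₁ : PCM.defined (sv₁.self.1 + sv₁.joint.1 + c.other) := by
      rw [← a, hself]
      exact hc
    have e : sv₁.transpose = ⟨(b.other, 0), sv₁.joint, sv₁.self⟩ :=
      State.ext (Prod.ext b'.symm d) rfl rfl
    refine ⟨⟨sv₁.self, sv₁.joint, (c.other, 0)⟩, ?_, ?_, hc, ?_, rfl, c', rfl⟩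
    -- The environment gives away all of its heap, passing through the state where that heap is
    -- empty, and then takes the new one. This imitates every kind of private step uniformly.
    · refine (hsv₁.tail (b := sv₁) (c := ⟨sv₁.self, sv₁.joint, (0, 0)⟩) ?_).tail ?_
      · refine ⟨stackGive layout b.other, Or.inr ⟨_, Or.inr rfl⟩, ?_⟩
        rw [e]
        exact ⟨hflat _ hb₁ 0 _ (zero_add _).symm, hflat _ hb₁ b.other 0 (add_zero _).symm,
          (add_zero _).symm, ⟨rfl, rfl⟩, rfl⟩
      · refine ⟨stackTake layout c.other, Or.inr ⟨_, Or.inl rfl⟩, ?_⟩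
        exact ⟨hflat _ hc₁ c.other 0 (add_zero _).symm, hflat _ hc₁ 0 _ (zero_add _).symm,
          (add_zero _).symm, ⟨rfl, rfl⟩, rfl⟩
    · exact ⟨hc₁, hv.2.1, by rw [← d]; exact hv.2.2⟩
    · rw [← hself, a]

/-- The family of quiescence. -/
noncomputable def quiescentFamily (hlayout : ∀ α, Precise (layout α))
    (ops : Set (StateRel (Heap Val × Hist) (Heap Val × List ℕ))) :
    Family (Stack layout ops) (Priv Val) Hist where
  rel := quiescentRel layout
  trans τ t := ⟨quiescentTrans layout τ t.1, quiescentTrans_internal hlayout τ t.2.1⟩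
  rel_space h := ⟨h.1, h.2.1⟩
  sim_int := by
    intro τ t sv sv' sw ht h
    have hi : IsInternal (stackSpace layout) stackFlat t.1 := t.2.1
    -- The new index is the self history after the step; since `t` fixes `other`, the others'
    -- history is still empty.
    have h' := quiescentRel_of_stackSpace (hi.preserves ht h.1)
      (by rw [← hi.other_fixed ht]; exact h.2.2.2.2.2)
    exact ⟨_, _, ⟨sv, sv', _, h, ht, h'⟩, h'⟩
  sim_other := quiescentRel.otherSteps
  functional := quiescentRel.functional hlayout
  frame := ⟨fun p => (p, 0), quiescentRel.frame⟩
  other_fixed h h' e := Prod.ext (h.2.2.2.1.symm.trans (e.trans h'.2.2.2.1))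
    (h.2.2.2.2.2.trans h'.2.2.2.2.2.symm)
  index_inj h h' := h.2.2.2.2.1.symm.trans h'.2.2.2.2.1

/-- An empty stack in the private heap is related to the initial state of the stack. -/
theorem quiescentRel_init {s : PrivState Val} (hs : privSpace s) (hl : layout [] s.self) :
    quiescentRel layout 0 ⟨0, (s.self, []), (s.other, 0)⟩ s := by
  refine ⟨⟨?_, hl, 0, ?_⟩, hs, (zero_add _).symm, rfl, rfl, rfl⟩
  · change PCM.defined (0 + s.self + s.other)
    rw [zero_add]
    exact hs
  · change IsLog 0 (0 + 0) []
    rw [add_zero]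
    exact .start

/-- As the thread keeps no private heap beside the stack, `s.self` is exactly the joint heap. As the
others' history is empty, the two pushes make up the entire log. -/
theorem quiescentRel.layout_of_histPost {τ : Hist} {sv : StackState Val} {s : PrivState Val}
    (h : quiescentRel layout τ sv s) (hQ : histPost sv) :
    layout [1, 2] s.self ∨ layout [2, 1] s.self := by
  obtain ⟨⟨-, hl, n, hn⟩, -, a, -, -, d⟩ := h
  obtain ⟨h₀, t₁, vs₁, t₂, vs₂, e⟩ := hQ
  rw [h₀, zero_add] at a
  rw [d, add_zero, e] at hn
  rw [a]
  rcases hn.two_pushes with hα | hα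
  · exact Or.inl (hα ▸ hl)
  · exact Or.inr (hα ▸ hl)

end Quiescence

end FCSL

/-! ### The family and the two lifted specifications -/

open FCSL

theorem mainTheorem4 {Val : Type} (layout : List ℕ → Heap Val → Prop)
    (hlayout : ∀ α, Precise (layout α))
    (ops : Set (StateRel (Heap Val × Hist) (Heap Val × List ℕ))) :
    (∃ f : Family (Stack layout ops) (Priv Val) Hist, f.rel = quiescentRel layout) ∧
    ∀ f : Family (Stack layout ops) (Priv Val) Hist, f.rel = quiescentRel layout →
      ∀ {A : Type} (e : Prog (Stack layout ops) A),
        Triple histPre e (fun _ => histPost) →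
          Triple (f.lift 0 histPre) (e.morph f 0) (fun _ s => ∃ τ, f.lift τ histPost s) ∧
          Triple (V := Priv Val) (fun s => layout [] s.self) (e.morph f 0)
            (fun _ s => layout [1, 2] s.self ∨ layout [2, 1] s.self) := by
  refine ⟨⟨quiescentFamily hlayout ops, rfl⟩, fun f hf A e h => ?_⟩
  have h' := Triple.morph (f := f) (x := (0 : Hist)) h
  refine ⟨h', h'.conseq (fun s hs hp => ?_) ?_⟩
  -- The whole private heap is taken as the joint heap of an empty stack, leaving no private
  -- remainder and no history.
  · refine ⟨⟨0, (s.self, []), (s.other, 0)⟩, ?_, rfl, rfl⟩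
    rw [hf]
    exact quiescentRel_init hs hp
  · rintro _ s ⟨τ, sv, hr, hQ⟩
    rw [hf] at hr
    exact hr.layout_of_histPost hQ
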